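/- Let $\mathbb{K}$ be a field, $m\ge 1$ and $d\ge 0$ integers. The degree of a polynomial matrix (or of one of its columns) is the largest degree of its entries, with $\deg 0=-\infty$. The leading matrix of a square matrix $A\in\mathbb{K}[y]^{k\times k}$ without zero columns has as entry $(i,j)$ the coefficient of degree $d_j$ of $A_{ij}$, where $d_j$ is the degree of column $j$; $A$ is \emph{weak Popov} if it has no zero column and its leading matrix is invertible and upper triangular. For $F\in\mathbb{K}[y]^{m\times k}$, an \emph{approximant basis of $F$ at order $\sigma$} is a matrix in $\mathbb{K}[y]^{k\times k}$ whose columns form a basis of the $\mathbb{K}[y]$-module $\{v\in\mathbb{K}[y]^{k}\mid Fv\equiv 0 \bmod y^\sigma\}$. For $H\in\mathbb{K}(y)^{m\times m}$, a \emph{right description} of $H$ is an equality $H=ND^{-1}$ with $N,D\in\mathbb{K}[y]^{m\times m}$ and $\det D\ne0$; it is \emph{irreducible} if every common right divisor of $N$ and $D$ is unimodular. A \emph{left description} is an equality $H=\hat D^{-1}\hat N$ with $\hat N,\hat D\in\mathbb{K}[y]^{m\times m}$ and $\det\hat D\neq 0$. The matrix $H$ is \emph{describable in degree $d$} if it has both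 a left and a right description with denominators ($\hat D$, resp. $D$) of degree at most $d$. It is \emph{strictly proper} if in each nonzero entry the degree of the numerator is less than that of the denominator. Let $H\in\mathbb{K}(y)^{m\times m}$ be strictly proper, and suppose that it has a power series expansion $H=\sum_{k\ge0}S_ky^k$ at $y=0$, with $S_k\in\mathbb{K}^{m\times m}$. Let $\delta$ be the determinantal degree of the module $\mathcal{D}(H)=\{v\in\mathbb{K}[y]^m\mid Hv\in\mathbb{K}[y]^m\}$, that is, the smallest degree of the determinant of a nonsingular matrix in $\mathbb{K}[y]^{m\times m}$ whose columns are in $\mathcal{D}(H)$ (equivalently, $\deg\det B$ for any basis matrix $B$ of $\mathcal{D}(H)$). Let $$F=\Big(\sum_{k=0}^{2d-1}S_ky^k\quad -I_m\Big)\in\mathbb{K}[y]^{m\times 2m},$$ and let $$P=\begin{pmatrix}D&P_1\\N&P_2\end{pmatrix}\in\mathbb{K}[y]^{2m\times 2m},$$ with blocks of size $m\times m$, be an approximant basis of $F$ at order $2d$ that is weak Popov. Then: (i) $D$ is weak Popov; $\deg N<\deg D$; the sum of the degrees of the diagonal entries of $D$ is equal to $\deg\det D$; and $\deg\det D\le\delta$.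 (ii) If $\deg\det D=\delta$ and each of the $m$ rightmost columns of $P$ has degree at least $\deg D$, then $ND^{-1}$ is an irreducible right description of $H$. (iii) If $H$ is describable in degree $d$, then $ND^{-1}$ is an irreducible right description of $H$, $\deg D\le d$, and each of the $m$ rightmost columns of $P$ has degree at least $\deg D$. -/

import Mathlib

noncomputable section

namespace MatFrac

open Polynomial

variable {K : Type*} [Field K]

/-- The degree of a polynomial matrix: the largest degree of its entries (`⊥` for the zero
matrix). -/
def matDegree {ℓ m : ℕ} (A : Matrix (Fin ℓ) (Fin m) K[X]) : WithBot ℕ :=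
  Finset.univ.sup fun i => Finset.univ.sup fun j => (A i j).degree

/-- The degree of column `j` of a polynomial matrix: the largest degree of its entries (`⊥` for
a zero column). -/
def colDegree {ℓ m : ℕ} (A : Matrix (Fin ℓ) (Fin m) K[X]) (j : Fin m) : WithBot ℕ :=
  Finset.univ.sup fun i => (A i j).degree

/-- The column leading matrix: its entry `(i, j)` is the coefficient of degree `colDegree A j` of
`A i j`. A zero column of `A` yields a zero column. -/
def leadingMatrix {m : ℕ} (A : Matrix (Fin m) (Fin m) K[X]) : Matrix (Fin m) (Fin m) K :=
  Matrix.of fun i j => (A i j).coeff ((colDegree A j).unbotD 0)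

/-- A square polynomial matrix is (column) reduced if its column leading matrix is invertible. -/
def IsColumnReduced {m : ℕ} (A : Matrix (Fin m) (Fin m) K[X]) : Prop :=
  IsUnit (leadingMatrix A).det

/-- A square polynomial matrix is in (column) weak Popov form if its column leading matrix is
invertible and upper triangular. -/
def IsWeakPopov {m : ℕ} (A : Matrix (Fin m) (Fin m) K[X]) : Prop :=
  IsColumnReduced A ∧ (leadingMatrix A).IsUpperTriangular

/-- The columns of `B` form a basis of the module `M`. -/
def IsColumnBasis {m : ℕ} (B : Matrix (Fin m) (Fin m) K[X])
    (M : Submodule K[X] (Fin m → K[X])) : Prop :=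
  LinearIndependent K[X] B.col ∧ Submodule.span K[X] (Set.range B.col) = M

/-- A polynomial matrix seen as a matrix of power series. -/
def toPowerSeries {ℓ m : ℕ} (A : Matrix (Fin ℓ) (Fin m) K[X]) :
    Matrix (Fin ℓ) (Fin m) (PowerSeries K) :=
  A.map fun p => (p : PowerSeries K)

/-- The module of the polynomial vectors `v` with `F v ≡ 0 mod y ^ σ`. -/
def approximantModule {m k : ℕ} (F : Matrix (Fin m) (Fin k) (PowerSeries K)) (σ : ℕ) :
    Submodule K[X] (Fin k → K[X]) where
  carrier := {v | ∀ i, (PowerSeries.X : PowerSeries K) ^ σ ∣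
    F.mulVec (fun j => (v j : PowerSeries K)) i}
  zero_mem' := by
    intro i
    simp [Matrix.mulVec, dotProduct]
  add_mem' := by
    intro v w hv hw i
    have h := dvd_add (hv i) (hw i)
    simpa [Matrix.mulVec, dotProduct, mul_add, Finset.sum_add_distrib] using h
  smul_mem' := by
    intro c v hv i
    have h := Dvd.dvd.mul_left (hv i) (c : PowerSeries K)
    simpa [Matrix.mulVec, dotProduct, Finset.mul_sum, mul_left_comm] using h

/-- `P` is an approximant basis of `F` at order `σ`. -/
def IsApproximantBasis {m k : ℕ} (P : Matrix (Fin k) (Fin k) K[X])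
    (F : Matrix (Fin m) (Fin k) (PowerSeries K)) (σ : ℕ) : Prop :=
  IsColumnBasis P (approximantModule F σ)

/-- A polynomial matrix seen as a matrix of rational functions. -/
def toRat {ℓ m : ℕ} (A : Matrix (Fin ℓ) (Fin m) K[X]) : Matrix (Fin ℓ) (Fin m) (RatFunc K) :=
  A.map (algebraMap K[X] (RatFunc K))

/-- `N D⁻¹` is a right fraction description of `F`. -/
def IsRightFraction {ℓ m : ℕ} (N : Matrix (Fin ℓ) (Fin m) K[X])
    (D : Matrix (Fin m) (Fin m) K[X]) (F : Matrix (Fin ℓ) (Fin m) (RatFunc K)) : Prop :=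
  D.det ≠ 0 ∧ F = toRat N * (toRat D)⁻¹

/-- `D⁻¹ N` is a left fraction description of `F`. -/
def IsLeftFraction {ℓ m : ℕ} (D : Matrix (Fin ℓ) (Fin ℓ) K[X])
    (N : Matrix (Fin ℓ) (Fin m) K[X]) (F : Matrix (Fin ℓ) (Fin m) (RatFunc K)) : Prop :=
  D.det ≠ 0 ∧ F = (toRat D)⁻¹ * toRat N

/-- `N` and `D` are right coprime: each common right divisor is unimodular. -/
def IsRightCoprime {ℓ m : ℕ} (N : Matrix (Fin ℓ) (Fin m) K[X])
    (D : Matrix (Fin m) (Fin m) K[X]) : Prop :=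
  ∀ (B : Matrix (Fin m) (Fin m) K[X]) (N' : Matrix (Fin ℓ) (Fin m) K[X])
    (D' : Matrix (Fin m) (Fin m) K[X]), N = N' * B → D = D' * B → IsUnit B.det

/-- `N D⁻¹` is an irreducible right fraction description of `F`. -/
def IsIrreducibleRightFraction {ℓ m : ℕ} (N : Matrix (Fin ℓ) (Fin m) K[X])
    (D : Matrix (Fin m) (Fin m) K[X]) (F : Matrix (Fin ℓ) (Fin m) (RatFunc K)) : Prop :=
  IsRightFraction N D F ∧ IsRightCoprime N D

/-- In each nonzero entry, the numerator has smaller degree than the denominator. -/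
def IsStrictlyProper {ℓ m : ℕ} (F : Matrix (Fin ℓ) (Fin m) (RatFunc K)) : Prop :=
  ∀ i j, F i j ≠ 0 → (F i j).num.degree < (F i j).denom.degree

/-- `F` has both a left and a right fraction description with denominators of degree at most
`d`. -/
def IsDescribable {ℓ m : ℕ} (F : Matrix (Fin ℓ) (Fin m) (RatFunc K)) (d : ℕ) : Prop :=
  (∃ (D : Matrix (Fin ℓ) (Fin ℓ) K[X]) (N : Matrix (Fin ℓ) (Fin m) K[X]),
    IsLeftFraction D N F ∧ matDegree D ≤ (d : WithBot ℕ)) ∧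
  (∃ (N : Matrix (Fin ℓ) (Fin m) K[X]) (D : Matrix (Fin m) (Fin m) K[X]),
    IsRightFraction N D F ∧ matDegree D ≤ (d : WithBot ℕ))

/-- The module of the polynomial vectors `v` such that `F v` is a polynomial vector. -/
def denomModule {ℓ m : ℕ} (F : Matrix (Fin ℓ) (Fin m) (RatFunc K)) :
    Submodule K[X] (Fin m → K[X]) where
  carrier := {v | ∃ w : Fin ℓ → K[X],
    F.mulVec (fun j => algebraMap K[X] (RatFunc K) (v j)) =
      fun i => algebraMap K[X] (RatFunc K) (w i)}
  zero_mem' := ⟨0, by ext i; simp [Matrix.mulVec, dotProduct]⟩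
  add_mem' := by
    rintro v v' ⟨w, hw⟩ ⟨w', hw'⟩
    refine ⟨w + w', ?_⟩
    ext i
    have h := congrFun hw i
    have h' := congrFun hw' i
    simp only [Matrix.mulVec, dotProduct] at h h' ⊢
    simp [mul_add, Finset.sum_add_distrib, h, h']
  smul_mem' := by
    rintro c v ⟨w, hw⟩
    refine ⟨c • w, ?_⟩
    ext i
    have h := congrFun hw i
    simp only [Matrix.mulVec, dotProduct] at h ⊢
    simp only [Pi.smul_apply, smul_eq_mul, map_mul]
    rw [← h, Finset.mul_sum]
    exact Finset.sum_congr rfl fun x _ => mul_left_comm _ _ _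

/-- The determinantal degree of a submodule of rank `m` of `K[y]^m`: the minimal degree of the
determinant of a nonsingular matrix whose columns belong to the module. The minimum is attained
exactly at the bases of the module. -/
def determinantalDegree {m : ℕ} (M : Submodule K[X] (Fin m → K[X])) : ℕ :=
  sInf {n | ∃ B : Matrix (Fin m) (Fin m) K[X],
    B.det ≠ 0 ∧ (∀ j, B.col j ∈ M) ∧ B.det.natDegree = n}

section

open scoped RatFunc

/-- `H = ∑ k, S k * y ^ k`, as an expansion in power series at `y = 0`. -/
def HasPowerSeriesExpansion {ℓ m : ℕ} (H : Matrix (Fin ℓ) (Fin m) (RatFunc K))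
    (S : ℕ → Matrix (Fin ℓ) (Fin m) K) : Prop :=
  ∀ i j, algebraMap (RatFunc K) (LaurentSeries K) (H i j) =
    HahnSeries.ofPowerSeries ℤ K (PowerSeries.mk fun k => S k i j)

end

/-- The polynomial matrix `∑ k < σ, S k * y ^ k`. -/
def truncation {ℓ m : ℕ} (S : ℕ → Matrix (Fin ℓ) (Fin m) K) (σ : ℕ) :
    Matrix (Fin ℓ) (Fin m) K[X] :=
  ∑ k ∈ Finset.range σ, (X : K[X]) ^ k • (S k).map C

/-- The block matrix `(A B)`. -/
def blockRow {m : ℕ} (A B : Matrix (Fin m) (Fin m) K[X]) : Matrix (Fin m) (Fin (m + m)) K[X] :=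
  (Matrix.fromCols A B).reindex (Equiv.refl _) finSumFinEquiv

/-- The block matrix with first block row `(A B)` and second block row `(C D)`. -/
def blockMatrix {m : ℕ} (A B C D : Matrix (Fin m) (Fin m) K[X]) :
    Matrix (Fin (m + m)) (Fin (m + m)) K[X] :=
  (Matrix.fromBlocks A B C D).reindex finSumFinEquiv finSumFinEquiv

end MatFrac

end

/-!
Write `H = G / q` with a scalar denominator `q`; strict properness says that every entry of `G` has
degree less than `deg q`. Let `P = (D P₁; N P₂)` be the weak Popov approximant basis. If `H B = E`
with polynomial `B`, `E`, then the columns of `(B; E)` are approximants at any order, so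
`(B; E) = P (U; V)`. Since `G B = q E`, block elimination gives
`q ^ m * det P * det U = det B * det (q P₂ - G P₁)`. The degree of `G` is too small to disturb the
leading matrix of `q P₂`, so `q P₂ - G P₁` is column reduced, with column degrees those of `P₂`
shifted by `deg q`. Comparing degrees yields `deg det B = deg det D + deg det U`. For `B` of minimal
determinantal degree `δ` this gives `deg det D ≤ δ`, and when equality holds `U` is unimodular, so
we may take `U = 1`; then `(q P₂ - G P₁) V = G D - q N` has a right-hand side of degree too small
to be reached by any nonzero `V`. Irreducibility is automatic once `H D = N`: if `D = D' B` and
`N = N' B`, then `(D'; N') = P (U; V)`, hence `P (U B; V B) = P (1; 0)` and `U B = 1`.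

A left denominator `A` of degree at most `d` turns an approximant `(v; w)` at order `2d`, with
`deg v ≤ d` and `deg w < d`, into an exact relation `H v = w`: the entries of `A H v - A w` are
polynomials of degree less than `2d` divisible by `y ^ (2d)`. A right denominator of degree at most
`d` bounds the column degrees of `D` by the predictable degree property. Finally, a column of
`(P₁; P₂)` of degree less than `d` would satisfy an exact relation, which the invertibility of
`q P₂ - G P₁` forbids.
-/

noncomputable section

namespace MatFrac

open Polynomial
open scoped Matrix

section DegreeMul

variable {R l m n : Type*} [Semiring R] [Fintype m] {A : Matrix l m R[X]} {B : Matrix m n R[X]}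
  {a b : ℕ}

lemma degree_mul_apply_lt_of_lt_of_le {i : l} {j : n} (hA : ∀ k, (A i k).degree < a)
    (hB : ∀ k, (B k j).degree ≤ b) : ((A * B) i j).degree < (a + b : ℕ) := by
  rw [Matrix.mul_apply, ← mem_degreeLT]
  refine Submodule.sum_mem _ fun k _ => mem_degreeLT.2 ((degree_mul_le _ _).trans_lt ?_)
  exact (add_le_add_right (hB k) _).trans_lt (WithBot.add_lt_add_right WithBot.coe_ne_bot (hA k))

lemma degree_mul_apply_lt_of_le_of_lt {i : l} {j : n} (hA : ∀ k, (A i k).degree ≤ a)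
    (hB : ∀ k, (B k j).degree < b) : ((A * B) i j).degree < (a + b : ℕ) := by
  rw [Matrix.mul_apply, ← mem_degreeLT]
  refine Submodule.sum_mem _ fun k _ => mem_degreeLT.2 ((degree_mul_le _ _).trans_lt ?_)
  exact (add_le_add_left (hA k) _).trans_lt (WithBot.add_lt_add_left WithBot.coe_ne_bot (hB k))

end DegreeMul

section ReducedDegrees

variable {R m n : Type*}

/-- The matrix of the coefficients of degree `s j` in column `j`: the leading matrix of a matrix
with column degrees `s`. -/
def coeffMatrix [Semiring R] (s : n → ℕ) (A : Matrix m n R[X]) : Matrix m n R :=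
  Matrix.of fun i j => (A i j).coeff (s j)

lemma coeff_prod_sum_of_natDegree_le [CommSemiring R] {T : Finset n} {f : n → R[X]} {s : n → ℕ}
    (h : ∀ i ∈ T, (f i).natDegree ≤ s i) :
    (∏ i ∈ T, f i).coeff (∑ i ∈ T, s i) = ∏ i ∈ T, (f i).coeff (s i) := by
  classical
  induction T using Finset.induction_on with
  | empty => simp
  | insert a T ha ih =>
    have hT : ∀ i ∈ T, (f i).natDegree ≤ s i := fun i hi => h i (Finset.mem_insert_of_mem hi)
    rw [Finset.prod_insert ha, Finset.sum_insert ha, Finset.prod_insert ha, ← ih hT]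
    exact coeff_mul_add_eq_of_natDegree_le (h a (Finset.mem_insert_self a T))
      ((natDegree_prod_le T f).trans (Finset.sum_le_sum hT))

variable [CommRing R] [Fintype n] [DecidableEq n]

lemma degree_det_le_sum {A : Matrix n n R[X]} {s : n → WithBot ℕ}
    (h : ∀ i j, (A i j).degree ≤ s j) : A.det.degree ≤ ∑ j, s j := by
  rw [Matrix.det_apply]
  refine (degree_sum_le _ _).trans (Finset.sup_le fun σ _ => ?_)
  calc (Equiv.Perm.sign σ • ∏ j, A (σ j) j).degree
      ≤ (∏ j, A (σ j) j).degree := degree_smul_le _ _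
    _ ≤ ∑ j, (A (σ j) j).degree := degree_prod_le _ _
    _ ≤ ∑ j, s j := Finset.sum_le_sum fun j _ => h (σ j) j

lemma coeff_det_sum {A : Matrix n n R[X]} {s : n → ℕ} (h : ∀ i j, (A i j).degree ≤ s j) :
    A.det.coeff (∑ j, s j) = (coeffMatrix s A).det := by
  simp only [Matrix.det_apply, finsetSum_coeff, coeff_smul]
  refine Finset.sum_congr rfl fun σ _ => congrArg _ ?_
  exact coeff_prod_sum_of_natDegree_le fun j _ => natDegree_le_iff_degree_le.2 (h (σ j) j)

/-- `A` is column reduced with column degrees `s`: over an index type other than `Fin m` this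
replaces the predicate `IsColumnReduced`, the column degrees being made explicit. -/
structure HasReducedDegrees (A : Matrix n n R[X]) (s : n → ℕ) : Prop where
  degree_le : ∀ i j, (A i j).degree ≤ s j
  det_coeffMatrix_ne_zero : (coeffMatrix s A).det ≠ 0

namespace HasReducedDegrees

variable {A : Matrix n n R[X]} {s : n → ℕ}

lemma degree_det (hA : HasReducedDegrees A s) : A.det.degree = ∑ j, (s j : WithBot ℕ) := by
  refine (degree_det_le_sum hA.degree_le).antisymm ?_
  rw [← Nat.cast_sum]
  exact le_degree_of_ne_zero (coeff_det_sum hA.degree_le ▸ hA.det_coeffMatrix_ne_zero)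

lemma det_ne_zero (hA : HasReducedDegrees A s) : A.det ≠ 0 := by
  intro h
  have hdeg := hA.degree_det
  rw [h, degree_zero, ← Nat.cast_sum] at hdeg
  exact WithBot.bot_ne_coe hdeg

/-- The predictable degree property, by Cramer's rule: replacing column `j` of `A` by `A u`
multiplies the determinant by `u j`, while its degree is at most the sum of the new column
degrees. -/
lemma add_degree_le_of_mulVec [NoZeroDivisors R] (hA : HasReducedDegrees A s) {u : n → R[X]}
    {t : WithBot ℕ} (ht : ∀ i, ((A *ᵥ u) i).degree ≤ t) (j : n) : s j + (u j).degree ≤ t := by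
  have hcramer : (A.updateCol j (A *ᵥ u)).det = A.det * u j := by
    rw [← Matrix.cramer_apply, Matrix.cramer_eq_adjugate_mulVec, Matrix.mulVec_mulVec,
      Matrix.adjugate_mul, Matrix.smul_mulVec, Matrix.one_mulVec, Pi.smul_apply, smul_eq_mul]
  have hcol : ∀ i k, (A.updateCol j (A *ᵥ u) i k).degree ≤
      Function.update (fun k => (s k : WithBot ℕ)) j t k := by
    intro i k
    rcases eq_or_ne k j with rfl | hk
    · simpa using ht i
    · simpa [hk] using hA.degree_le i k
  have hle := degree_det_le_sum hcol
  rw [hcramer, degree_mul, hA.degree_det, Finset.sum_update_of_mem (Finset.mem_univ j),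
    ← Finset.add_sum_erase _ _ (Finset.mem_univ j), add_right_comm,
    Finset.sdiff_singleton_eq_erase, ← Nat.cast_sum] at hle
  exact (WithBot.add_le_add_iff_right (WithBot.coe_ne_bot)).1 hle

end HasReducedDegrees

end ReducedDegrees

section Blocks

variable {R m n : Type*} [CommRing R] [Fintype m] [Fintype n] [DecidableEq n]

lemma HasReducedDegrees.smul_sub_mul [NoZeroDivisors R] {G : Matrix n m R[X]}
    {P₁ : Matrix m n R[X]} {P₂ : Matrix n n R[X]} {q : R[X]} {r : n → ℕ}
    (hP₂ : HasReducedDegrees P₂ r) (hP₁ : ∀ i j, (P₁ i j).degree ≤ r j) (hq : q ≠ 0)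
    (hG : ∀ i j, (G i j).degree < q.degree) :
    HasReducedDegrees (q • P₂ - G * P₁) fun j => q.natDegree + r j := by
  have hGP : ∀ i j, ((G * P₁) i j).degree < (q.natDegree + r j : ℕ) := fun i j =>
    degree_mul_apply_lt_of_lt_of_le (fun k => degree_eq_natDegree hq ▸ hG i k) fun k => hP₁ k j
  have hqP : ∀ i j, ((q • P₂) i j).degree ≤ (q.natDegree + r j : ℕ) := fun i j => by
    rw [Matrix.smul_apply, smul_eq_mul, degree_mul, Nat.cast_add, ← degree_eq_natDegree hq]
    exact add_le_add_right (hP₂.degree_le i j) _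
  refine ⟨fun i j => (degree_sub_le _ _).trans (max_le (hqP i j) (hGP i j).le), ?_⟩
  have hcoeff : coeffMatrix (fun j => q.natDegree + r j) (q • P₂ - G * P₁) =
      q.leadingCoeff • coeffMatrix r P₂ := by
    ext i j
    simp only [coeffMatrix, Matrix.of_apply, Matrix.sub_apply, Matrix.smul_apply, smul_eq_mul,
      coeff_sub, coeff_eq_zero_of_degree_lt (hGP i j), sub_zero]
    exact coeff_mul_add_eq_of_natDegree_le le_rfl
      (natDegree_le_iff_degree_le.2 (hP₂.degree_le i j))
  rw [hcoeff, Matrix.det_smul]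
  exact mul_ne_zero (pow_ne_zero _ (leadingCoeff_ne_zero.2 hq)) hP₂.det_coeffMatrix_ne_zero

variable [DecidableEq m]

lemma pow_mul_det_fromBlocks_mul_det {D U B : Matrix m m R} {P₁ : Matrix m n R}
    {N V E G : Matrix n m R} {P₂ : Matrix n n R} {q : R} (hB : D * U + P₁ * V = B)
    (hE : N * U + P₂ * V = E) (hG : G * B = q • E) :
    q ^ Fintype.card n * (Matrix.fromBlocks D P₁ N P₂).det * U.det =
      B.det * (q • P₂ - G * P₁).det := by
  have hmul : Matrix.fromBlocks 1 0 (-G) (q • 1) * (Matrix.fromBlocks D P₁ N P₂ *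
      Matrix.fromBlocks U 0 V 1) = Matrix.fromBlocks B P₁ 0 (q • P₂ - G * P₁) := by
    simp only [Matrix.fromBlocks_multiply, hB, hE, Matrix.one_mul, Matrix.mul_one, Matrix.zero_mul,
      Matrix.mul_zero, zero_add, add_zero, Matrix.neg_mul, Matrix.smul_mul, hG, neg_add_cancel,
      neg_add_eq_sub]
  simpa only [Matrix.det_mul, Matrix.det_fromBlocks_zero₁₂, Matrix.det_fromBlocks_zero₂₁,
    Matrix.det_one, Matrix.det_smul, one_mul, mul_one, ← mul_assoc] using congrArg Matrix.det hmul

/-- The shape of a weak Popov matrix `(D P₁; N P₂)` that matters for fractions: the leading matrix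
of the columns, which have degrees `s` and `r`, is block upper triangular and invertible. -/
structure IsBlockReduced (D : Matrix m m R[X]) (P₁ : Matrix m n R[X]) (N : Matrix n m R[X])
    (P₂ : Matrix n n R[X]) (s : m → ℕ) (r : n → ℕ) : Prop where
  reduced_D : HasReducedDegrees D s
  degree_N_lt : ∀ i j, (N i j).degree < s j
  degree_P₁_le : ∀ i j, (P₁ i j).degree ≤ r j
  reduced_P₂ : HasReducedDegrees P₂ r

namespace IsBlockReduced

variable [NoZeroDivisors R] {D U B : Matrix m m R[X]} {P₁ : Matrix m n R[X]}
  {N V E G : Matrix n m R[X]} {P₂ : Matrix n n R[X]} {q : R[X]} {s : m → ℕ} {r : n → ℕ}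

lemma hasReducedDegrees_fromBlocks (h : IsBlockReduced D P₁ N P₂ s r) :
    HasReducedDegrees (Matrix.fromBlocks D P₁ N P₂) (Sum.elim s r) where
  degree_le := by
    rintro (i | i) (j | j)
    exacts [h.reduced_D.degree_le i j, h.degree_P₁_le i j, (h.degree_N_lt i j).le,
      h.reduced_P₂.degree_le i j]
  det_coeffMatrix_ne_zero := by
    have hblocks : coeffMatrix (Sum.elim s r) (Matrix.fromBlocks D P₁ N P₂) =
        Matrix.fromBlocks (coeffMatrix s D) (coeffMatrix r P₁) 0 (coeffMatrix r P₂) := by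
      ext (i | i) (j | j)
      exacts [rfl, rfl, coeff_eq_zero_of_degree_lt (h.degree_N_lt i j), rfl]
    rw [hblocks, Matrix.det_fromBlocks_zero₂₁]
    exact mul_ne_zero h.reduced_D.det_coeffMatrix_ne_zero h.reduced_P₂.det_coeffMatrix_ne_zero

lemma degree_det_eq_add (h : IsBlockReduced D P₁ N P₂ s r) (hq : q ≠ 0)
    (hGq : ∀ i j, (G i j).degree < q.degree) (hB : D * U + P₁ * V = B)
    (hE : N * U + P₂ * V = E) (hG : G * B = q • E) :
    B.det.degree = D.det.degree + U.det.degree := by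
  have : Nontrivial R := Nontrivial.of_polynomial_ne hq
  have hdeg := congrArg degree (pow_mul_det_fromBlocks_mul_det hB hE hG)
  rw [degree_mul, degree_mul, degree_mul, degree_pow, degree_eq_natDegree hq,
    h.hasReducedDegrees_fromBlocks.degree_det,
    (h.reduced_P₂.smul_sub_mul h.degree_P₁_le hq hGq).degree_det, Fintype.sum_sum_type] at hdeg
  simp only [Sum.elim_inl, Sum.elim_inr, Nat.cast_add, Finset.sum_add_distrib, Finset.sum_const,
    Finset.card_univ, ← h.reduced_D.degree_det] at hdeg
  have hc : Fintype.card n • (q.natDegree : WithBot ℕ) + ∑ j, (r j : WithBot ℕ) ≠ ⊥ := by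
    exact_mod_cast WithBot.coe_ne_bot
  refine WithBot.add_right_cancel hc ?_
  rw [← hdeg]
  ac_rfl

lemma eq_zero_of_le (h : IsBlockReduced D P₁ N P₂ s r) (hq : q ≠ 0)
    (hGq : ∀ i j, (G i j).degree < q.degree)
    (hG : G * (D + P₁ * V) = q • (N + P₂ * V)) (hsr : ∀ i j, s j ≤ r i) : V = 0 := by
  have hV : (q • P₂ - G * P₁) * V = G * D - q • N := by
    rw [Matrix.mul_add, smul_add, ← Matrix.mul_assoc, ← Matrix.smul_mul] at hG
    rw [Matrix.sub_mul, sub_eq_sub_iff_add_eq_add, add_comm, ← hG]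
  have hlt : ∀ i j, ((G * D - q • N) i j).degree < (q.natDegree + s j : ℕ) := fun i j => by
    refine (degree_sub_le _ _).trans_lt (max_lt ?_ ?_)
    · exact degree_mul_apply_lt_of_lt_of_le (fun k => degree_eq_natDegree hq ▸ hGq i k)
        fun k => h.reduced_D.degree_le k j
    · rw [Matrix.smul_apply, smul_eq_mul, degree_mul, degree_eq_natDegree hq, Nat.cast_add]
      exact WithBot.add_lt_add_left WithBot.coe_ne_bot (h.degree_N_lt i j)
  ext1 i j
  by_contra hij
  have hle := (h.reduced_P₂.smul_sub_mul h.degree_P₁_le hq hGq).add_degree_le_of_mulVec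
    (u := V.col j) (t := Finset.univ.sup fun k => ((G * D - q • N) k j).degree)
    (fun k => hV ▸ Finset.le_sup (f := fun k => (((q • P₂ - G * P₁) * V) k j).degree)
      (Finset.mem_univ k)) i
  have hsup := (Finset.sup_lt_iff (WithBot.bot_lt_coe _)).2 fun k (_ : k ∈ Finset.univ) => hlt k j
  rw [Matrix.col_apply, degree_eq_natDegree hij] at hle
  have hlt' : q.natDegree + r i + (V i j).natDegree < q.natDegree + s j := by
    exact_mod_cast hle.trans_lt hsup
  have := hsr i j
  omega

lemma le_of_degree_le (h : IsBlockReduced D P₁ N P₂ s r) {d : ℕ}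
    (hU : U.det ≠ 0) (hB : ∀ i j, ((D * U + P₁ * V) i j).degree ≤ d)
    (hE : ∀ i j, ((N * U + P₂ * V) i j).degree ≤ d) (i : m) : s i ≤ d := by
  obtain ⟨j, hij⟩ : ∃ j, U i j ≠ 0 := by
    by_contra! hU₀
    exact hU (Matrix.det_eq_zero_of_row_eq_zero i hU₀)
  have hd : ∀ k, ((Matrix.fromBlocks D P₁ N P₂ *ᵥ Sum.elim (U.col j) (V.col j)) k).degree ≤ d := by
    rw [Matrix.fromBlocks_mulVec]
    rintro (k | k)
    exacts [hB k j, hE k j]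
  have hle := h.hasReducedDegrees_fromBlocks.add_degree_le_of_mulVec hd (Sum.inl i)
  simp only [Sum.elim_inl, Matrix.col_apply, degree_eq_natDegree hij] at hle
  exact (Nat.le_add_right _ _).trans (by exact_mod_cast hle)

end IsBlockReduced

end Blocks

section WeakPopov

variable {K : Type*} [Field K] {l m k : ℕ}

lemma matDegree_le_iff {A : Matrix (Fin l) (Fin m) K[X]} {t : WithBot ℕ} :
    matDegree A ≤ t ↔ ∀ i j, (A i j).degree ≤ t := by
  simp [matDegree, Finset.sup_le_iff]

lemma matDegree_lt_iff {A : Matrix (Fin l) (Fin m) K[X]} {t : WithBot ℕ} (ht : ⊥ < t) :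
    matDegree A < t ↔ ∀ i j, (A i j).degree < t := by
  simp [matDegree, Finset.sup_lt_iff ht]

lemma degree_le_matDegree (A : Matrix (Fin l) (Fin m) K[X]) (i : Fin l) (j : Fin m) :
    (A i j).degree ≤ matDegree A :=
  matDegree_le_iff.1 le_rfl i j

lemma degree_le_colDegree (A : Matrix (Fin l) (Fin m) K[X]) (i : Fin l) (j : Fin m) :
    (A i j).degree ≤ colDegree A j :=
  Finset.le_sup (f := fun i => (A i j).degree) (Finset.mem_univ i)

lemma colDegree_eq_of_degree_le {A : Matrix (Fin l) (Fin m) K[X]} {i : Fin l} {j : Fin m}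
    (h : ∀ k, (A k j).degree ≤ (A i j).degree) : colDegree A j = (A i j).degree :=
  (Finset.sup_le fun k _ => h k).antisymm (degree_le_colDegree A i j)

lemma leadingMatrix_apply_eq_coeff_natDegree {A : Matrix (Fin m) (Fin m) K[X]} {j : Fin m}
    (h : colDegree A j = (A j j).degree) (i : Fin m) :
    leadingMatrix A i j = (A i j).coeff (A j j).natDegree := by
  rw [leadingMatrix, Matrix.of_apply, h, natDegree]

lemma IsWeakPopov.leadingMatrix_diag_ne_zero {A : Matrix (Fin m) (Fin m) K[X]}
    (hA : IsWeakPopov A) (j : Fin m) : leadingMatrix A j j ≠ 0 := by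
  have hdet := hA.1.ne_zero
  rw [Matrix.det_of_isUpperTriangular hA.2] at hdet
  exact Finset.prod_ne_zero_iff.1 hdet j (Finset.mem_univ j)

lemma IsWeakPopov.colDegree_eq {A : Matrix (Fin m) (Fin m) K[X]} (hA : IsWeakPopov A)
    (j : Fin m) : colDegree A j = (A j j).degree :=
  ((WithBot.le_coe_unbotD _ 0).trans
    (le_degree_of_ne_zero (hA.leadingMatrix_diag_ne_zero j))).antisymm (degree_le_colDegree A j j)

lemma isWeakPopov_iff {A : Matrix (Fin m) (Fin m) K[X]} :
    IsWeakPopov A ↔ ∀ j, A j j ≠ 0 ∧ (∀ i, (A i j).degree ≤ (A j j).degree) ∧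
      ∀ i, j < i → (A i j).degree < (A j j).degree := by
  constructor
  · intro hA j
    have hlead := leadingMatrix_apply_eq_coeff_natDegree (hA.colDegree_eq j)
    have hjj : A j j ≠ 0 := fun h0 =>
      hA.leadingMatrix_diag_ne_zero j (by rw [hlead, h0, coeff_zero])
    have hle : ∀ i, (A i j).degree ≤ (A j j).degree := fun i =>
      hA.colDegree_eq j ▸ degree_le_colDegree A i j
    refine ⟨hjj, hle, fun i hij => (hle i).lt_of_ne fun heq => ?_⟩
    have hcoeff : (A i j).coeff (A i j).natDegree = 0 := by
      rw [natDegree_eq_of_degree_eq heq, ← hlead]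
      exact hA.2 hij
    rw [leadingCoeff_eq_zero.1 hcoeff, degree_zero] at heq
    exact hjj (degree_eq_bot.1 heq.symm)
  · intro hA
    have hlead : ∀ i j, leadingMatrix A i j = (A i j).coeff (A j j).natDegree := fun i j =>
      leadingMatrix_apply_eq_coeff_natDegree (colDegree_eq_of_degree_le (hA j).2.1) i
    have hupper : (leadingMatrix A).IsUpperTriangular := fun i j hij => by
      rw [hlead]
      exact coeff_eq_zero_of_degree_lt ((hA j).2.2 i hij |>.trans_le degree_le_natDegree)
    refine ⟨isUnit_iff_ne_zero.2 ?_, hupper⟩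
    rw [Matrix.det_of_isUpperTriangular hupper, Finset.prod_ne_zero_iff]
    exact fun j _ => hlead j j ▸ leadingCoeff_ne_zero.2 (hA j).1

namespace IsWeakPopov

lemma submatrix {A : Matrix (Fin m) (Fin m) K[X]} (hA : IsWeakPopov A) (f : Fin k ↪o Fin m) :
    IsWeakPopov (A.submatrix f f) :=
  isWeakPopov_iff.2 fun j =>
    have ⟨hne, hle, hlt⟩ := isWeakPopov_iff.1 hA (f j)
    ⟨hne, fun i => hle (f i), fun i hij => hlt (f i) (f.lt_iff_lt.2 hij)⟩

lemma hasReducedDegrees {A : Matrix (Fin m) (Fin m) K[X]} (hA : IsWeakPopov A) :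
    HasReducedDegrees A fun j => (A j j).natDegree where
  degree_le i j := ((isWeakPopov_iff.1 hA j).2.1 i).trans degree_le_natDegree
  det_coeffMatrix_ne_zero := by
    have hlead : coeffMatrix (fun j => (A j j).natDegree) A = leadingMatrix A := by
      ext i j
      exact (leadingMatrix_apply_eq_coeff_natDegree (hA.colDegree_eq j) i).symm
    exact hlead ▸ hA.1.ne_zero

lemma degree_det {A : Matrix (Fin m) (Fin m) K[X]} (hA : IsWeakPopov A) :
    A.det.degree = ∑ j, (A j j).degree :=
  hA.hasReducedDegrees.degree_det.trans <| Finset.sum_congr rfl fun j _ =>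
    (degree_eq_natDegree (isWeakPopov_iff.1 hA j).1).symm

end IsWeakPopov

variable {D P₁ N P₂ : Matrix (Fin m) (Fin m) K[X]}

lemma blockMatrix_finSumFinEquiv (D P₁ N P₂ : Matrix (Fin m) (Fin m) K[X])
    (i j : Fin m ⊕ Fin m) : blockMatrix D P₁ N P₂ (finSumFinEquiv i) (finSumFinEquiv j) =
      Matrix.fromBlocks D P₁ N P₂ i j := by
  rw [blockMatrix, Matrix.reindex_apply, Matrix.submatrix_apply, Equiv.symm_apply_apply,
    Equiv.symm_apply_apply]

namespace IsWeakPopov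

variable (hP : IsWeakPopov (blockMatrix D P₁ N P₂))
include hP

lemma topLeft_of_blockMatrix : IsWeakPopov D := by
  convert hP.submatrix (Fin.castAddOrderEmb m) using 1
  ext1 i j
  exact (blockMatrix_finSumFinEquiv D P₁ N P₂ (.inl i) (.inl j)).symm

lemma bottomRight_of_blockMatrix : IsWeakPopov P₂ := by
  convert hP.submatrix (Fin.natAddOrderEmb m) using 1
  ext1 i j
  exact (blockMatrix_finSumFinEquiv D P₁ N P₂ (.inr i) (.inr j)).symm

lemma degree_bottomLeft_lt_of_blockMatrix (i j : Fin m) : (N i j).degree < (D j j).degree := by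
  have hlt := (isWeakPopov_iff.1 hP (Fin.castAdd m j)).2.2 (Fin.natAdd m i)
    (j.isLt.trans_le (Nat.le_add_right m i))
  rwa [← finSumFinEquiv_apply_left, ← finSumFinEquiv_apply_right, blockMatrix_finSumFinEquiv,
    blockMatrix_finSumFinEquiv] at hlt

lemma degree_topRight_le_of_blockMatrix (i j : Fin m) : (P₁ i j).degree ≤ (P₂ j j).degree := by
  have hle := (isWeakPopov_iff.1 hP (Fin.natAdd m j)).2.1 (Fin.castAdd m i)
  rwa [← finSumFinEquiv_apply_left, ← finSumFinEquiv_apply_right, blockMatrix_finSumFinEquiv,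
    blockMatrix_finSumFinEquiv] at hle

lemma isBlockReduced_of_blockMatrix : IsBlockReduced D P₁ N P₂
    (fun j => (D j j).natDegree) fun j => (P₂ j j).natDegree where
  reduced_D := hP.topLeft_of_blockMatrix.hasReducedDegrees
  degree_N_lt i j := (hP.degree_bottomLeft_lt_of_blockMatrix i j).trans_le degree_le_natDegree
  degree_P₁_le i j := (hP.degree_topRight_le_of_blockMatrix i j).trans degree_le_natDegree
  reduced_P₂ := hP.bottomRight_of_blockMatrix.hasReducedDegrees

lemma colDegree_blockMatrix_natAdd (j : Fin m) :
    colDegree (blockMatrix D P₁ N P₂) (Fin.natAdd m j) = (P₂ j j).degree :=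
  (hP.colDegree_eq _).trans
    (congrArg degree (blockMatrix_finSumFinEquiv D P₁ N P₂ (.inr j) (.inr j)))

lemma matDegree_lt_of_blockMatrix (hm : 0 < m) : matDegree N < matDegree D := by
  have hlt : ∀ i j, (N i j).degree < matDegree D := fun i j =>
    (hP.degree_bottomLeft_lt_of_blockMatrix i j).trans_le (degree_le_matDegree D j j)
  exact (matDegree_lt_iff (bot_le.trans_lt (hlt ⟨0, hm⟩ ⟨0, hm⟩))).2 hlt

end IsWeakPopov

end WeakPopov

section Fractions

variable {K : Type*} [Field K] {l m n : ℕ}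

lemma toRat_mul (A : Matrix (Fin l) (Fin m) K[X]) (B : Matrix (Fin m) (Fin n) K[X]) :
    toRat (A * B) = toRat A * toRat B :=
  Matrix.map_mul

lemma toRat_smul (q : K[X]) (A : Matrix (Fin l) (Fin m) K[X]) :
    toRat (q • A) = algebraMap K[X] (RatFunc K) q • toRat A :=
  Matrix.ext fun i j => map_mul (algebraMap K[X] (RatFunc K)) q (A i j)

lemma toRat_injective :
    Function.Injective (toRat : Matrix (Fin l) (Fin m) K[X] → Matrix (Fin l) (Fin m) (RatFunc K)) :=
  Matrix.map_injective (RatFunc.algebraMap_injective K)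

lemma isUnit_det_toRat {A : Matrix (Fin m) (Fin m) K[X]} (hA : A.det ≠ 0) :
    IsUnit (toRat A).det := by
  have hdet : (toRat A).det = algebraMap K[X] (RatFunc K) A.det :=
    (RingHom.map_det (algebraMap K[X] (RatFunc K)) A).symm
  rw [hdet]
  exact (RatFunc.algebraMap_ne_zero hA).isUnit

variable {H : Matrix (Fin l) (Fin m) (RatFunc K)}

lemma isRightFraction_iff {N : Matrix (Fin l) (Fin m) K[X]} {D : Matrix (Fin m) (Fin m) K[X]} :
    IsRightFraction N D H ↔ D.det ≠ 0 ∧ H * toRat D = toRat N :=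
  and_congr_right fun hD => by
    have := (toRat D).invertibleOfIsUnitDet (isUnit_det_toRat hD)
    exact eq_comm.trans ((Matrix.mul_inv_eq_iff_eq_mul_of_invertible _ _ _).trans eq_comm)

lemma isLeftFraction_iff {D : Matrix (Fin l) (Fin l) K[X]} {N : Matrix (Fin l) (Fin m) K[X]} :
    IsLeftFraction D N H ↔ D.det ≠ 0 ∧ toRat D * H = toRat N :=
  and_congr_right fun hD => by
    have := (toRat D).invertibleOfIsUnitDet (isUnit_det_toRat hD)
    exact eq_comm.trans ((Matrix.inv_mul_eq_iff_eq_mul_of_invertible _ _ _).trans eq_comm)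

/-- `H = G / q`, with a common denominator `q` of the entries of `H`. -/
structure IsScalarFraction (G : Matrix (Fin l) (Fin m) K[X]) (q : K[X])
    (H : Matrix (Fin l) (Fin m) (RatFunc K)) : Prop where
  ne_zero : q ≠ 0
  smul_eq : algebraMap K[X] (RatFunc K) q • H = toRat G

lemma exists_isScalarFraction (H : Matrix (Fin l) (Fin m) (RatFunc K)) :
    ∃ G q, IsScalarFraction G q H := by
  obtain ⟨q, hq⟩ := IsLocalization.exist_integer_multiples_of_finite (nonZeroDivisors K[X])
    fun ij : Fin l × Fin m => H ij.1 ij.2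
  choose G hG using fun i j => hq (i, j)
  refine ⟨Matrix.of G, q, nonZeroDivisors.coe_ne_zero q, Matrix.ext fun i j => ?_⟩
  exact (Algebra.smul_def _ _).symm.trans (hG i j).symm

namespace IsScalarFraction

variable {G : Matrix (Fin l) (Fin m) K[X]} {q : K[X]} (h : IsScalarFraction G q H)
include h

lemma mul_toRat_eq_iff {B : Matrix (Fin m) (Fin n) K[X]} {E : Matrix (Fin l) (Fin n) K[X]} :
    H * toRat B = toRat E ↔ G * B = q • E := by
  rw [← toRat_injective.eq_iff, toRat_smul, toRat_mul, ← h.smul_eq, Matrix.smul_mul,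
    (smul_right_injective _ (RatFunc.algebraMap_ne_zero h.ne_zero)).eq_iff]

lemma toRat_mul_eq_iff {A : Matrix (Fin n) (Fin l) K[X]} {M : Matrix (Fin n) (Fin m) K[X]} :
    toRat A * H = toRat M ↔ A * G = q • M := by
  rw [← toRat_injective.eq_iff, toRat_smul, toRat_mul, ← h.smul_eq, Matrix.mul_smul,
    (smul_right_injective _ (RatFunc.algebraMap_ne_zero h.ne_zero)).eq_iff]

lemma degree_lt (hH : IsStrictlyProper H) (i : Fin l) (j : Fin m) :
    (G i j).degree < q.degree := by
  have hG : algebraMap K[X] (RatFunc K) q * H i j = algebraMap K[X] (RatFunc K) (G i j) :=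
    congrFun₂ h.smul_eq i j
  rcases eq_or_ne (H i j) 0 with h0 | h0
  · rw [h0, mul_zero] at hG
    rw [(map_eq_zero_iff _ (RatFunc.algebraMap_injective K)).1 hG.symm, degree_zero]
    exact bot_lt_iff_ne_bot.2 (degree_ne_bot.2 h.ne_zero)
  · have hnum : (H i j).num * q = G i j * (H i j).denom :=
      (RatFunc.num_mul_eq_mul_denom_iff h.ne_zero).2
        (eq_div_of_mul_eq (RatFunc.algebraMap_ne_zero h.ne_zero) (mul_comm _ _ |>.trans hG))
    have hlt : (G i j * (H i j).denom).degree < (q * (H i j).denom).degree := by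
      rw [← hnum, mul_comm, degree_mul, degree_mul, degree_eq_natDegree h.ne_zero]
      exact WithBot.add_lt_add_left WithBot.coe_ne_bot (hH i j h0)
    rw [degree_mul, degree_mul] at hlt
    exact lt_of_add_lt_add_right hlt

end IsScalarFraction

lemma IsStrictlyProper.degree_lt_of_mul_toRat_eq (hH : IsStrictlyProper H)
    {B : Matrix (Fin m) (Fin n) K[X]} {E : Matrix (Fin l) (Fin n) K[X]}
    (hE : H * toRat B = toRat E) {b : ℕ} {j : Fin n} (hB : ∀ k, (B k j).degree ≤ b)
    (i : Fin l) : (E i j).degree < b := by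
  obtain ⟨G, q, hG⟩ := exists_isScalarFraction H
  have hlt := degree_mul_apply_lt_of_lt_of_le (A := G) (B := B) (i := i)
    (fun k => degree_eq_natDegree hG.ne_zero ▸ hG.degree_lt hH i k) hB
  rw [hG.mul_toRat_eq_iff.1 hE, Matrix.smul_apply, smul_eq_mul, degree_mul,
    degree_eq_natDegree hG.ne_zero, Nat.cast_add] at hlt
  exact lt_of_add_lt_add_left hlt

lemma IsStrictlyProper.degree_lt_of_toRat_mul_eq (hH : IsStrictlyProper H)
    {A : Matrix (Fin n) (Fin l) K[X]} {M : Matrix (Fin n) (Fin m) K[X]}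
    (hM : toRat A * H = toRat M) {a : ℕ} {i : Fin n} (hA : ∀ k, (A i k).degree ≤ a)
    (j : Fin m) : (M i j).degree < a := by
  obtain ⟨G, q, hG⟩ := exists_isScalarFraction H
  have hlt := degree_mul_apply_lt_of_le_of_lt (A := A) (B := G) (j := j) hA
    fun k => degree_eq_natDegree hG.ne_zero ▸ hG.degree_lt hH k j
  rw [hG.toRat_mul_eq_iff.1 hM, Matrix.smul_apply, smul_eq_mul, degree_mul,
    degree_eq_natDegree hG.ne_zero, add_comm a, Nat.cast_add] at hlt
  exact lt_of_add_lt_add_left hlt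

lemma forall_col_mem_denomModule_iff {B : Matrix (Fin m) (Fin n) K[X]} :
    (∀ j, B.col j ∈ denomModule H) ↔ ∃ E, H * toRat B = toRat E := by
  constructor
  · intro h
    choose w hw using h
    exact ⟨Matrix.of fun i j => w j i, Matrix.ext fun i j => congrFun (hw j) i⟩
  · rintro ⟨E, hE⟩ j
    exact ⟨E.col j, funext fun i => congrFun₂ hE i j⟩

lemma exists_degree_det_eq_determinantalDegree (H : Matrix (Fin l) (Fin m) (RatFunc K)) :
    ∃ B E, B.det ≠ 0 ∧ H * toRat B = toRat E ∧
      B.det.degree = (determinantalDegree (denomModule H) : WithBot ℕ) := by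
  obtain ⟨G, q, hG⟩ := exists_isScalarFraction H
  have hqG : H * toRat (q • (1 : Matrix (Fin m) (Fin m) K[X])) = toRat G :=
    hG.mul_toRat_eq_iff.2 (by rw [Matrix.mul_smul, Matrix.mul_one])
  have hdet : (q • (1 : Matrix (Fin m) (Fin m) K[X])).det ≠ 0 := by
    rw [Matrix.det_smul, Matrix.det_one, mul_one]
    exact pow_ne_zero _ hG.ne_zero
  obtain ⟨B, hB, hcol, hdeg⟩ := Nat.sInf_mem (s := {n | ∃ B : Matrix (Fin m) (Fin m) K[X],
    B.det ≠ 0 ∧ (∀ j, B.col j ∈ denomModule H) ∧ B.det.natDegree = n})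
    ⟨_, _, hdet, forall_col_mem_denomModule_iff.2 ⟨G, hqG⟩, rfl⟩
  obtain ⟨E, hE⟩ := forall_col_mem_denomModule_iff.1 hcol
  exact ⟨B, E, hB, hE, (degree_eq_natDegree hB).trans (congrArg _ hdeg)⟩

end Fractions

section PowerSeries

open scoped RatFunc

variable {K : Type*} [Field K] {l m n : ℕ}

lemma toPowerSeries_mul (A : Matrix (Fin l) (Fin m) K[X]) (B : Matrix (Fin m) (Fin n) K[X]) :
    toPowerSeries (A * B) = toPowerSeries A * toPowerSeries B :=
  Matrix.map_mul (f := coeToPowerSeries.ringHom)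

lemma toPowerSeries_sub (A B : Matrix (Fin l) (Fin m) K[X]) :
    toPowerSeries (A - B) = toPowerSeries A - toPowerSeries B :=
  Matrix.map_sub coeToPowerSeries.ringHom (map_sub _) A B

lemma map_toRat (A : Matrix (Fin l) (Fin m) K[X]) :
    (toRat A).map (algebraMap (RatFunc K) (LaurentSeries K)) =
      (toPowerSeries A).map (HahnSeries.ofPowerSeries ℤ K) :=
  Matrix.ext fun i j => (RatFunc.coe_coe (A i j)).symm

/-- The matrix of power series `∑ k, S k * y ^ k`. -/
def seriesMatrix (S : ℕ → Matrix (Fin l) (Fin m) K) : Matrix (Fin l) (Fin m) (PowerSeries K) :=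
  Matrix.of fun i j => PowerSeries.mk fun k => S k i j

namespace HasPowerSeriesExpansion

variable {H : Matrix (Fin l) (Fin m) (RatFunc K)} {S : ℕ → Matrix (Fin l) (Fin m) K}
  (hS : HasPowerSeriesExpansion H S)
include hS

lemma map_eq : H.map (algebraMap (RatFunc K) (LaurentSeries K)) =
    (seriesMatrix S).map (HahnSeries.ofPowerSeries ℤ K) :=
  Matrix.ext hS

lemma seriesMatrix_mul_eq {B : Matrix (Fin m) (Fin n) K[X]} {E : Matrix (Fin l) (Fin n) K[X]}
    (h : H * toRat B = toRat E) : seriesMatrix S * toPowerSeries B = toPowerSeries E := by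
  apply Matrix.map_injective (HahnSeries.ofPowerSeries_injective (Γ := ℤ))
  simp only [Matrix.map_mul, ← map_toRat, ← hS.map_eq, ← h]

lemma mul_seriesMatrix_eq {A : Matrix (Fin n) (Fin l) K[X]} {M : Matrix (Fin n) (Fin m) K[X]}
    (h : toRat A * H = toRat M) : toPowerSeries A * seriesMatrix S = toPowerSeries M := by
  apply Matrix.map_injective (HahnSeries.ofPowerSeries_injective (Γ := ℤ))
  simp only [Matrix.map_mul, ← map_toRat, ← hS.map_eq, ← h]

end HasPowerSeriesExpansion

lemma eq_zero_of_X_pow_dvd_coe {p : K[X]} {σ : ℕ} (hp : p.degree < σ)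
    (h : (PowerSeries.X : PowerSeries K) ^ σ ∣ (p : PowerSeries K)) : p = 0 := by
  refine eq_zero_of_dvd_of_degree_lt (X_pow_dvd_iff.2 fun k hk => ?_) (degree_X_pow (R := K) σ ▸ hp)
  rw [← coeff_coe]
  exact PowerSeries.X_pow_dvd_iff.1 h k hk

lemma dvd_mul_apply_of_forall_dvd {R l m n : Type*} [CommSemiring R] [Fintype m] {a : R}
    {A : Matrix l m R} {B : Matrix m n R} {j : n} (h : ∀ k, a ∣ B k j) (i : l) :
    a ∣ (A * B) i j :=
  Finset.dvd_sum fun k _ => (h k).mul_left (A i k)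

lemma IsLeftFraction.mul_toRat_eq_of_X_pow_dvd {H : Matrix (Fin l) (Fin m) (RatFunc K)}
    {S : ℕ → Matrix (Fin l) (Fin m) K} (hS : HasPowerSeriesExpansion H S)
    (hH : IsStrictlyProper H) {A : Matrix (Fin l) (Fin l) K[X]} {M : Matrix (Fin l) (Fin m) K[X]}
    (hA : IsLeftFraction A M H) {V : Matrix (Fin m) (Fin n) K[X]}
    {W : Matrix (Fin l) (Fin n) K[X]} {a b : ℕ} (hAa : ∀ i j, (A i j).degree ≤ a)
    (hV : ∀ i j, (V i j).degree ≤ b) (hW : ∀ i j, (W i j).degree < b)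
    (hdvd : ∀ i j, (PowerSeries.X : PowerSeries K) ^ (a + b) ∣
      (seriesMatrix S * toPowerSeries V - toPowerSeries W) i j) :
    H * toRat V = toRat W := by
  obtain ⟨hdet, hM⟩ := isLeftFraction_iff.1 hA
  have hMV : M * V - A * W = 0 := by
    ext1 i j
    refine eq_zero_of_X_pow_dvd_coe (σ := a + b) ((degree_sub_le _ _).trans_lt (max_lt ?_ ?_)) ?_
    · exact degree_mul_apply_lt_of_lt_of_le (hH.degree_lt_of_toRat_mul_eq hM (hAa i))
        fun k => hV k j
    · exact degree_mul_apply_lt_of_le_of_lt (hAa i) fun k => hW k j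
    · have hseries : toPowerSeries (M * V - A * W) =
          toPowerSeries A * (seriesMatrix S * toPowerSeries V - toPowerSeries W) := by
        rw [toPowerSeries_sub, toPowerSeries_mul, toPowerSeries_mul, ← hS.mul_seriesMatrix_eq hM,
          Matrix.mul_assoc, Matrix.mul_sub]
      change _ ∣ toPowerSeries (M * V - A * W) i j
      rw [hseries]
      exact dvd_mul_apply_of_forall_dvd (fun k => hdvd k j) i
  have := (toRat A).invertibleOfIsUnitDet (isUnit_det_toRat hdet)
  apply Matrix.mul_right_injective_of_invertible (toRat A)
  simp only [← Matrix.mul_assoc, hM, ← toRat_mul, sub_eq_zero.1 hMV]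

end PowerSeries

section ColumnBasis

variable {K : Type*} [Field K] {m n : ℕ} {B : Matrix (Fin m) (Fin m) K[X]}
  {M : Submodule K[X] (Fin m → K[X])}

namespace IsColumnBasis

lemma mem_iff (hB : IsColumnBasis B M) {v : Fin m → K[X]} : v ∈ M ↔ ∃ u, B *ᵥ u = v := by
  rw [← hB.2, ← Matrix.range_mulVecLin, LinearMap.mem_range]
  rfl

lemma col_mul_mem (hB : IsColumnBasis B M) (Y : Matrix (Fin m) (Fin n) K[X]) (j : Fin n) :
    (B * Y).col j ∈ M :=
  hB.mem_iff.2 ⟨Y.col j, rfl⟩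

lemma exists_mul_eq (hB : IsColumnBasis B M) {Y : Matrix (Fin m) (Fin n) K[X]}
    (hY : ∀ j, Y.col j ∈ M) : ∃ W, B * W = Y := by
  choose w hw using fun j => hB.mem_iff.1 (hY j)
  exact ⟨Matrix.of fun i j => w j i, Matrix.ext fun i j => congrFun (hw j) i⟩

lemma mul_left_injective (hB : IsColumnBasis B M) :
    Function.Injective fun Y : Matrix (Fin m) (Fin n) K[X] => B * Y := fun _ _ h =>
  Matrix.ext_col fun j => Matrix.mulVec_injective_iff.2 hB.1 (congrArg (Matrix.col · j) h)

end IsColumnBasis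

end ColumnBasis

section Approximants

variable {K : Type*} [Field K] {m n : ℕ}

/-- The block matrix with first block row `V` and second block row `W`. -/
def blockCol (V W : Matrix (Fin m) (Fin n) K[X]) : Matrix (Fin (m + m)) (Fin n) K[X] :=
  (Matrix.fromRows V W).reindex finSumFinEquiv (Equiv.refl _)

lemma exists_eq_blockCol (Y : Matrix (Fin (m + m)) (Fin n) K[X]) : ∃ V W, Y = blockCol V W := by
  refine ⟨(Y.submatrix finSumFinEquiv id).toRows₁, (Y.submatrix finSumFinEquiv id).toRows₂, ?_⟩
  rw [blockCol, Matrix.fromRows_toRows]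
  ext i j
  simp

lemma blockCol_inj {V W V' W' : Matrix (Fin m) (Fin n) K[X]} :
    blockCol V W = blockCol V' W' ↔ V = V' ∧ W = W' := by
  rw [blockCol, blockCol, EmbeddingLike.apply_eq_iff_eq, Matrix.fromRows_ext_iff]

lemma blockMatrix_mul_blockCol (D P₁ N P₂ : Matrix (Fin m) (Fin m) K[X])
    (U V : Matrix (Fin m) (Fin n) K[X]) :
    blockMatrix D P₁ N P₂ * blockCol U V = blockCol (D * U + P₁ * V) (N * U + P₂ * V) := by
  simp only [blockMatrix, blockCol, Matrix.reindex_apply, Matrix.submatrix_mul_equiv,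
    Matrix.fromBlocks_mul_fromRows]

lemma X_pow_dvd_truncation_sub (S : ℕ → Matrix (Fin m) (Fin n) K) (σ : ℕ) (i : Fin m)
    (j : Fin n) : (PowerSeries.X : PowerSeries K) ^ σ ∣
      (toPowerSeries (truncation S σ) - seriesMatrix S) i j := by
  refine PowerSeries.X_pow_dvd_iff.2 fun k hk => ?_
  simp [toPowerSeries, seriesMatrix, truncation, Matrix.sum_apply, hk]

lemma col_blockCol_mem_approximantModule_iff {S : ℕ → Matrix (Fin m) (Fin m) K} {σ : ℕ}
    {V W : Matrix (Fin m) (Fin n) K[X]} {j : Fin n} :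
    (blockCol V W).col j ∈ approximantModule (toPowerSeries (blockRow (truncation S σ) (-1))) σ ↔
      ∀ i, (PowerSeries.X : PowerSeries K) ^ σ ∣
        (seriesMatrix S * toPowerSeries V - toPowerSeries W) i j := by
  have hrow : blockRow (truncation S σ) (-1) * blockCol V W = truncation S σ * V - W := by
    rw [blockRow, blockCol, Matrix.reindex_apply, Matrix.reindex_apply,
      Matrix.submatrix_mul_equiv, Matrix.fromCols_mul_fromRows, Matrix.neg_mul, Matrix.one_mul,
      ← sub_eq_add_neg]
    rfl
  refine forall_congr' fun i => ?_
  change _ ∣ (toPowerSeries (blockRow (truncation S σ) (-1)) * toPowerSeries (blockCol V W)) i j ↔ _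
  rw [← toPowerSeries_mul, hrow, toPowerSeries_sub, toPowerSeries_mul]
  refine dvd_iff_dvd_of_dvd_sub ?_
  have hsub : toPowerSeries (truncation S σ) * toPowerSeries V - toPowerSeries W -
      (seriesMatrix S * toPowerSeries V - toPowerSeries W) =
      (toPowerSeries (truncation S σ) - seriesMatrix S) * toPowerSeries V := by
    rw [sub_sub_sub_cancel_right, Matrix.sub_mul]
  rw [← Matrix.sub_apply, hsub, Matrix.mul_apply]
  exact Finset.dvd_sum fun k _ => (X_pow_dvd_truncation_sub S σ i k).mul_right _

end Approximants

section RightDescriptions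

variable {K : Type*} [Field K] {m n σ a b : ℕ} {H : Matrix (Fin m) (Fin m) (RatFunc K)}
  {S : ℕ → Matrix (Fin m) (Fin m) K} {A M D P₁ N P₂ : Matrix (Fin m) (Fin m) K[X]}
  {s r : Fin m → ℕ}

lemma IsBlockReduced.degree_det_eq_add_of_isStrictlyProper
    (hred : IsBlockReduced D P₁ N P₂ s r) (hH : IsStrictlyProper H)
    {U V B E : Matrix (Fin m) (Fin m) K[X]} (hE : H * toRat B = toRat E)
    (hU : D * U + P₁ * V = B) (hV : N * U + P₂ * V = E) :
    B.det.degree = D.det.degree + U.det.degree := by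
  obtain ⟨G, q, hG⟩ := exists_isScalarFraction H
  exact hred.degree_det_eq_add hG.ne_zero (hG.degree_lt hH) hU hV (hG.mul_toRat_eq_iff.1 hE)

namespace IsApproximantBasis

lemma X_pow_dvd_seriesMatrix_mul_sub (hP : IsApproximantBasis (blockMatrix D P₁ N P₂)
    (toPowerSeries (blockRow (truncation S σ) (-1))) σ) (U V : Matrix (Fin m) (Fin n) K[X])
    (i : Fin m) (j : Fin n) : (PowerSeries.X : PowerSeries K) ^ σ ∣
      (seriesMatrix S * toPowerSeries (D * U + P₁ * V) - toPowerSeries (N * U + P₂ * V)) i j := by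
  have hmem := IsColumnBasis.col_mul_mem hP (blockCol U V) j
  rw [blockMatrix_mul_blockCol] at hmem
  exact col_blockCol_mem_approximantModule_iff.1 hmem i

lemma exists_mul_add_mul_eq (hP : IsApproximantBasis (blockMatrix D P₁ N P₂)
    (toPowerSeries (blockRow (truncation S σ) (-1))) σ) (hS : HasPowerSeriesExpansion H S)
    {B E : Matrix (Fin m) (Fin n) K[X]} (hE : H * toRat B = toRat E) :
    ∃ U V : Matrix (Fin m) (Fin n) K[X], D * U + P₁ * V = B ∧ N * U + P₂ * V = E := by
  obtain ⟨Y, hY⟩ := IsColumnBasis.exists_mul_eq hP (Y := blockCol B E) fun j =>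
    col_blockCol_mem_approximantModule_iff.2 fun i => by
      rw [hS.seriesMatrix_mul_eq hE, sub_self]
      exact dvd_zero _
  obtain ⟨U, V, rfl⟩ := exists_eq_blockCol Y
  exact ⟨U, V, blockCol_inj.1 (blockMatrix_mul_blockCol D P₁ N P₂ U V ▸ hY)⟩

lemma isIrreducibleRightFraction (hP : IsApproximantBasis (blockMatrix D P₁ N P₂)
    (toPowerSeries (blockRow (truncation S σ) (-1))) σ) (hS : HasPowerSeriesExpansion H S)
    (hD : D.det ≠ 0) (hN : H * toRat D = toRat N) : IsIrreducibleRightFraction N D H := by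
  refine ⟨isRightFraction_iff.2 ⟨hD, hN⟩, fun B N' D' hNB hDB => ?_⟩
  have hB : B.det ≠ 0 := right_ne_zero_of_mul (Matrix.det_mul D' B ▸ hDB ▸ hD)
  have := (toRat B).invertibleOfIsUnitDet (isUnit_det_toRat hB)
  have hN' : H * toRat D' = toRat N' := by
    apply Matrix.mul_left_injective_of_invertible (toRat B)
    simp only [Matrix.mul_assoc, ← toRat_mul, ← hNB, ← hDB, hN]
  obtain ⟨U, V, hU, hV⟩ := hP.exists_mul_add_mul_eq hS hN'
  have hcol : blockMatrix D P₁ N P₂ * blockCol (U * B) (V * B) =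
      blockMatrix D P₁ N P₂ * blockCol (1 : Matrix (Fin m) (Fin m) K[X]) 0 := by
    rw [blockMatrix_mul_blockCol, blockMatrix_mul_blockCol, ← Matrix.mul_assoc,
      ← Matrix.mul_assoc, ← Matrix.mul_assoc, ← Matrix.mul_assoc, ← Matrix.add_mul,
      ← Matrix.add_mul, hU, hV, ← hDB, ← hNB, Matrix.mul_one, Matrix.mul_one, Matrix.mul_zero,
      Matrix.mul_zero, add_zero, add_zero]
  have hUB := (blockCol_inj.1 (IsColumnBasis.mul_left_injective hP hcol)).1
  exact Matrix.isUnit_det_of_left_inverse hUB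

lemma degree_det_le_determinantalDegree (hP : IsApproximantBasis (blockMatrix D P₁ N P₂)
    (toPowerSeries (blockRow (truncation S σ) (-1))) σ) (hS : HasPowerSeriesExpansion H S)
    (hH : IsStrictlyProper H) (hred : IsBlockReduced D P₁ N P₂ s r) :
    D.det.degree ≤ (determinantalDegree (denomModule H) : WithBot ℕ) := by
  obtain ⟨B, E, hB, hE, hdeg⟩ := exists_degree_det_eq_determinantalDegree H
  obtain ⟨U, V, hU, hV⟩ := hP.exists_mul_add_mul_eq hS hE
  have hadd := hred.degree_det_eq_add_of_isStrictlyProper hH hE hU hV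
  have hdetU : U.det ≠ 0 := fun h0 => hB (degree_eq_bot.1 (by
    rw [hadd, h0, degree_zero, WithBot.add_bot]))
  rw [← hdeg, hadd]
  exact le_add_of_nonneg_right (zero_le_degree_iff.2 hdetU)

lemma mul_toRat_eq_of_degree_det_eq (hP : IsApproximantBasis (blockMatrix D P₁ N P₂)
    (toPowerSeries (blockRow (truncation S σ) (-1))) σ) (hS : HasPowerSeriesExpansion H S)
    (hH : IsStrictlyProper H) (hred : IsBlockReduced D P₁ N P₂ s r) (hsr : ∀ i j, s j ≤ r i)
    (hdet : D.det.degree = (determinantalDegree (denomModule H) : WithBot ℕ)) :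
    H * toRat D = toRat N := by
  obtain ⟨B, E, -, hE, hdeg⟩ := exists_degree_det_eq_determinantalDegree H
  obtain ⟨U, V, hU, hV⟩ := hP.exists_mul_add_mul_eq hS hE
  have hdetU : IsUnit U.det := by
    have hadd := hred.degree_det_eq_add_of_isStrictlyProper hH hE hU hV
    have hD : D.det.degree ≠ ⊥ := degree_ne_bot.2 hred.reduced_D.det_ne_zero
    rw [hdeg, ← hdet] at hadd
    rw [isUnit_iff_degree_eq_zero]
    exact WithBot.add_left_cancel hD (by rw [← hadd, add_zero])
  obtain ⟨V', hV'⟩ : ∃ V' : Matrix (Fin m) (Fin m) K[X], V * U⁻¹ = V' := ⟨_, rfl⟩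
  have hB' : B * U⁻¹ = D + P₁ * V' := by
    rw [← hU, Matrix.add_mul, Matrix.mul_nonsing_inv_cancel_right _ _ hdetU, Matrix.mul_assoc, hV']
  have hE' : E * U⁻¹ = N + P₂ * V' := by
    rw [← hV, Matrix.add_mul, Matrix.mul_nonsing_inv_cancel_right _ _ hdetU, Matrix.mul_assoc, hV']
  have hH' : H * toRat (D + P₁ * V') = toRat (N + P₂ * V') := by
    rw [← hB', ← hE', toRat_mul, toRat_mul, ← Matrix.mul_assoc]
    exact congrArg (· * toRat U⁻¹) hE
  obtain ⟨G, q, hG⟩ := exists_isScalarFraction H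
  have hV₀ := hred.eq_zero_of_le hG.ne_zero (hG.degree_lt hH) (hG.mul_toRat_eq_iff.1 hH') hsr
  rwa [hV₀, Matrix.mul_zero, Matrix.mul_zero, add_zero, add_zero] at hH'

lemma le_of_isRightFraction (hP : IsApproximantBasis (blockMatrix D P₁ N P₂)
    (toPowerSeries (blockRow (truncation S σ) (-1))) σ) (hS : HasPowerSeriesExpansion H S)
    (hH : IsStrictlyProper H) (hred : IsBlockReduced D P₁ N P₂ s r) (hA : IsRightFraction M A H)
    (hAa : ∀ i j, (A i j).degree ≤ a) (i : Fin m) : s i ≤ a := by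
  obtain ⟨hdetA, hM⟩ := isRightFraction_iff.1 hA
  obtain ⟨U, V, hU, hV⟩ := hP.exists_mul_add_mul_eq hS hM
  have hdetU : U.det ≠ 0 := fun h0 => hdetA <| degree_eq_bot.1 <| by
    rw [hred.degree_det_eq_add_of_isStrictlyProper hH hM hU hV, h0, degree_zero, WithBot.add_bot]
  exact hred.le_of_degree_le hdetU (hU.symm ▸ hAa)
    (hV.symm ▸ fun i j => (hH.degree_lt_of_mul_toRat_eq hM (hAa · j) i).le) i

lemma mul_toRat_eq_of_isLeftFraction (hP : IsApproximantBasis (blockMatrix D P₁ N P₂)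
    (toPowerSeries (blockRow (truncation S (a + b)) (-1))) (a + b))
    (hS : HasPowerSeriesExpansion H S) (hH : IsStrictlyProper H)
    (hred : IsBlockReduced D P₁ N P₂ s r) (hA : IsLeftFraction A M H)
    (hAa : ∀ i j, (A i j).degree ≤ a) (hsb : ∀ j, s j ≤ b) : H * toRat D = toRat N := by
  refine hA.mul_toRat_eq_of_X_pow_dvd hS hH hAa (b := b) ?_ ?_ ?_
  · exact fun i j => (hred.reduced_D.degree_le i j).trans (Nat.cast_le.2 (hsb j))
  · exact fun i j => (hred.degree_N_lt i j).trans_le (Nat.cast_le.2 (hsb j))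
  · have hdvd := hP.X_pow_dvd_seriesMatrix_mul_sub (1 : Matrix (Fin m) (Fin m) K[X]) 0
    simpa only [Matrix.mul_zero, Matrix.mul_one, add_zero] using hdvd

lemma le_of_isLeftFraction (hP : IsApproximantBasis (blockMatrix D P₁ N P₂)
    (toPowerSeries (blockRow (truncation S (a + b)) (-1))) (a + b))
    (hS : HasPowerSeriesExpansion H S) (hH : IsStrictlyProper H)
    (hred : IsBlockReduced D P₁ N P₂ s r) (hA : IsLeftFraction A M H)
    (hAa : ∀ i j, (A i j).degree ≤ a) (j : Fin m) : b ≤ r j := by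
  by_contra! hrb
  have hcol : H * toRat (P₁.submatrix id fun _ : Fin 1 => j) =
      toRat (P₂.submatrix id fun _ : Fin 1 => j) := by
    refine hA.mul_toRat_eq_of_X_pow_dvd hS hH hAa (b := b) ?_ ?_ ?_
    · exact fun i _ => (hred.degree_P₁_le i j).trans (Nat.cast_le.2 hrb.le)
    · exact fun i _ => (hred.reduced_P₂.degree_le i j).trans_lt (Nat.cast_lt.2 hrb)
    · have hdvd := hP.X_pow_dvd_seriesMatrix_mul_sub 0 (1 : Matrix (Fin m) (Fin m) K[X])
      simp only [Matrix.mul_zero, Matrix.mul_one, zero_add] at hdvd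
      exact fun i _ => hdvd i j
  obtain ⟨G, q, hG⟩ := exists_isScalarFraction H
  have hzero : ∀ i, (q • P₂ - G * P₁) i j = 0 := fun i =>
    sub_eq_zero.2 (congrFun₂ (hG.mul_toRat_eq_iff.1 hcol) i 0).symm
  exact (hred.reduced_P₂.smul_sub_mul hred.degree_P₁_le hG.ne_zero (hG.degree_lt hH)).det_ne_zero
    (Matrix.det_eq_zero_of_column_eq_zero j hzero)

end IsApproximantBasis

end RightDescriptions

end MatFrac

end

theorem mainTheorem7 {K : Type*} [Field K] {m : ℕ} (hm : 0 < m) (d : ℕ)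
    (H : Matrix (Fin m) (Fin m) (RatFunc K)) (hH : MatFrac.IsStrictlyProper H)
    (S : ℕ → Matrix (Fin m) (Fin m) K) (hS : MatFrac.HasPowerSeriesExpansion H S)
    (D P₁ N P₂ : Matrix (Fin m) (Fin m) (Polynomial K))
    (hP : MatFrac.IsApproximantBasis (MatFrac.blockMatrix D P₁ N P₂)
      (MatFrac.toPowerSeries (MatFrac.blockRow (MatFrac.truncation S (2 * d)) (-1))) (2 * d))
    (hPopov : MatFrac.IsWeakPopov (MatFrac.blockMatrix D P₁ N P₂)) :
    (MatFrac.IsWeakPopov D ∧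
      MatFrac.matDegree N < MatFrac.matDegree D ∧
      D.det.degree = ∑ i, (D i i).degree ∧
      D.det.degree ≤ (MatFrac.determinantalDegree (MatFrac.denomModule H) : WithBot ℕ)) ∧
    (D.det.degree = (MatFrac.determinantalDegree (MatFrac.denomModule H) : WithBot ℕ) →
      (∀ j : Fin m, MatFrac.matDegree D ≤
        MatFrac.colDegree (MatFrac.blockMatrix D P₁ N P₂) (Fin.natAdd m j)) →
      MatFrac.IsIrreducibleRightFraction N D H) ∧
    (MatFrac.IsDescribable H d →
      MatFrac.IsIrreducibleRightFraction N D H ∧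
      MatFrac.matDegree D ≤ (d : WithBot ℕ) ∧
      ∀ j : Fin m, MatFrac.matDegree D ≤
        MatFrac.colDegree (MatFrac.blockMatrix D P₁ N P₂) (Fin.natAdd m j)) := by
  have hred := hPopov.isBlockReduced_of_blockMatrix
  have hD := hPopov.topLeft_of_blockMatrix
  have hP₂ := MatFrac.isWeakPopov_iff.1 hPopov.bottomRight_of_blockMatrix
  rw [two_mul] at hP
  refine ⟨⟨hD, hPopov.matDegree_lt_of_blockMatrix hm, hD.degree_det,
    hP.degree_det_le_determinantalDegree hS hH hred⟩, fun hdet hcol => ?_, fun hdesc => ?_⟩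
  · have hsr (i j : Fin m) : (D j j).natDegree ≤ (P₂ i i).natDegree :=
      Polynomial.natDegree_le_natDegree <| (MatFrac.degree_le_matDegree D j j).trans <|
        (hcol i).trans_eq (hPopov.colDegree_blockMatrix_natAdd i)
    exact hP.isIrreducibleRightFraction hS hred.reduced_D.det_ne_zero
      (hP.mul_toRat_eq_of_degree_det_eq hS hH hred hsr hdet)
  · obtain ⟨⟨A, M, hA, hAd⟩, M', A', hA', hAd'⟩ := hdesc
    have hs := hP.le_of_isRightFraction hS hH hred hA' (MatFrac.matDegree_le_iff.1 hAd')
    have hr := hP.le_of_isLeftFraction hS hH hred hA (MatFrac.matDegree_le_iff.1 hAd)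
    have hDd : MatFrac.matDegree D ≤ d := MatFrac.matDegree_le_iff.2 fun i j =>
      (hred.reduced_D.degree_le i j).trans (Nat.cast_le.2 (hs j))
    refine ⟨hP.isIrreducibleRightFraction hS hred.reduced_D.det_ne_zero
      (hP.mul_toRat_eq_of_isLeftFraction hS hH hred hA (MatFrac.matDegree_le_iff.1 hAd) hs),
      hDd, fun j => hDd.trans ?_⟩
    rw [hPopov.colDegree_blockMatrix_natAdd, Polynomial.degree_eq_natDegree (hP₂ j).1]
    exact Nat.cast_le.2 (hr j)
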